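/- Let $k$ be a field of characteristic zero, and let $\mathcal{OA}$ (the Dolan–Grady algebra) be the Lie algebra over $k$ presented by generators $A$, $B$ and the relations $$[A,[A,[A,B]]] = 4[A,B], \qquad [B,[B,[B,A]]] = 4[B,A].$$ Put $A_0 = A$, $A_1 = B$, $G_1 = \tfrac12[A_1,A_0]$, and define $A_m, G_m \in \mathcal{OA}$ for all $m \in \mathbb{Z}$ by $$A_{m+1} - A_{m-1} = [G_1, A_m], \qquad G_m = \tfrac12[A_m,A_0].$$ Then these elements satisfy Onsager's relations: for all $l, m \in \mathbb{Z}$, $$[A_l,A_m] = 2G_{l-m}, \qquad [G_l,A_m] = A_{m+l} - A_{m-l}, \qquad [G_l,G_m] = 0.$$ In particular, $[A_l,A_m]$ depends only on $l-m$: if $l-m = l'-m'$ with $l,m,l',m' \in \mathbb{Z}$, then $[A_l,A_m] = [A_{l'},A_{m'}]$. -/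

import Mathlib

noncomputable section

namespace DolanGrady

/-- The two generators of the Dolan-Grady algebra. -/
inductive Gen : Type
  | A
  | B

/-- The Dolan-Grady relators `[A,[A,[A,B]]] - 4[A,B]` and `[B,[B,[B,A]]] - 4[B,A]`
in the free Lie algebra on the generators `A`, `B`. -/
def relators (k : Type*) [Field k] : Set (FreeLieAlgebra k Gen) :=
  let a := FreeLieAlgebra.of k Gen.A
  let b := FreeLieAlgebra.of k Gen.B
  {⁅a, ⁅a, ⁅a, b⁆⁆⁆ - (4 : k) • ⁅a, b⁆, ⁅b, ⁅b, ⁅b, a⁆⁆⁆ - (4 : k) • ⁅b, a⁆}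

/-- The Lie ideal generated by the Dolan-Grady relators. -/
def relIdeal (k : Type*) [Field k] : LieIdeal k (FreeLieAlgebra k Gen) :=
  LieSubmodule.lieSpan k (FreeLieAlgebra k Gen) (relators k)

/-- The Dolan-Grady algebra: the Lie algebra over `k` presented by the generators `A`, `B` and
the relations `[A,[A,[A,B]]] = 4[A,B]` and `[B,[B,[B,A]]] = 4[B,A]`. -/
abbrev OA (k : Type*) [Field k] : Type _ := FreeLieAlgebra k Gen ⧸ relIdeal k

/-- The class of a generator in the Dolan-Grady algebra. -/
def gen (k : Type*) [Field k] (x : Gen) : OA k :=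
  LieSubmodule.Quotient.mk (N := relIdeal k) (FreeLieAlgebra.of k x)

/-- `G_1 = ½ [A_1, A_0]`, where `A_0 = A` and `A_1 = B`. -/
def G₁ (k : Type*) [Field k] : OA k := (1 / 2 : k) • ⁅gen k Gen.B, gen k Gen.A⁆

/-- The elements `A_n` for `n ≥ 0`, by upward recursion. -/
def up (k : Type*) [Field k] : ℕ → OA k
  | 0 => gen k Gen.A
  | 1 => gen k Gen.B
  | n + 2 => up k n + ⁅G₁ k, up k (n + 1)⁆

/-- The elements `A_{1-n}` for `n ≥ 0`, by downward recursion. -/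
def down (k : Type*) [Field k] : ℕ → OA k
  | 0 => gen k Gen.B
  | 1 => gen k Gen.A
  | n + 2 => down k n - ⁅G₁ k, down k (n + 1)⁆

/-- The elements `A_m`, `m ∈ ℤ`: the unique family with `A_0 = A`, `A_1 = B` and
`A_{m+1} - A_{m-1} = [G_1, A_m]` for every integer `m`; see `A_succ_sub_pred` and `A_unique`. -/
def A (k : Type*) [Field k] : ℤ → OA k
  | Int.ofNat n => up k n
  | Int.negSucc n => down k (n + 2)

/-- The elements `G_m = ½ [A_m, A_0]`, `m ∈ ℤ`. -/
def G (k : Type*) [Field k] (m : ℤ) : OA k := (1 / 2 : k) • ⁅A k m, A k 0⁆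

theorem A_zero (k : Type*) [Field k] : A k 0 = gen k Gen.A := rfl

theorem A_one (k : Type*) [Field k] : A k 1 = gen k Gen.B := rfl

theorem G_one (k : Type*) [Field k] : G k 1 = G₁ k := rfl

/-- The generators satisfy the first Dolan-Grady relation. -/
theorem dolanGrady_one (k : Type*) [Field k] :
    ⁅A k 0, ⁅A k 0, ⁅A k 0, A k 1⁆⁆⁆ = (4 : k) • ⁅A k 0, A k 1⁆ := by
  refine sub_eq_zero.mp ((LieSubmodule.Quotient.mk_eq_zero' (N := relIdeal k)).mpr ?_)
  exact LieSubmodule.subset_lieSpan (Or.inl rfl)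

/-- The generators satisfy the second Dolan-Grady relation. -/
theorem dolanGrady_two (k : Type*) [Field k] :
    ⁅A k 1, ⁅A k 1, ⁅A k 1, A k 0⁆⁆⁆ = (4 : k) • ⁅A k 1, A k 0⁆ := by
  refine sub_eq_zero.mp ((LieSubmodule.Quotient.mk_eq_zero' (N := relIdeal k)).mpr ?_)
  exact LieSubmodule.subset_lieSpan (Or.inr rfl)

/-- The defining recursion of the `A_m`, for every integer `m`. -/
theorem A_succ_sub_pred (k : Type*) [Field k] (m : ℤ) :
    A k (m + 1) - A k (m - 1) = ⁅G k 1, A k m⁆ := by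
  rw [G_one]
  match m with
  | Int.ofNat 0 =>
    change up k 1 - (down k 0 - ⁅G₁ k, down k 1⁆) = ⁅G₁ k, up k 0⁆
    simp [up, down]
  | Int.ofNat (n + 1) =>
    have h1 : (Int.ofNat (n + 1) + 1 : ℤ) = Int.ofNat (n + 2) := by simp; ring
    have h2 : (Int.ofNat (n + 1) - 1 : ℤ) = Int.ofNat n := by simp
    rw [h1, h2]
    change up k n + ⁅G₁ k, up k (n + 1)⁆ - up k n = ⁅G₁ k, up k (n + 1)⁆
    abel
  | Int.negSucc 0 =>
    change down k 1 - (down k 1 - ⁅G₁ k, down k 2⁆) = ⁅G₁ k, down k 2⁆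
    abel
  | Int.negSucc (n + 1) =>
    have h1 : (Int.negSucc (n + 1) + 1 : ℤ) = Int.negSucc n := by
      simp only [Int.negSucc_eq]; push_cast; ring
    have h2 : (Int.negSucc (n + 1) - 1 : ℤ) = Int.negSucc (n + 2) := by
      simp only [Int.negSucc_eq]; push_cast; ring
    rw [h1, h2]
    change down k (n + 2) - (down k (n + 2) - ⁅G₁ k, down k (n + 3)⁆) = ⁅G₁ k, down k (n + 3)⁆
    abel

/-- The initial values and the recursion determine the `A_m`. -/
theorem A_unique (k : Type*) [Field k] (f : ℤ → OA k) (h0 : f 0 = gen k Gen.A)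
    (h1 : f 1 = gen k Gen.B) (h : ∀ m : ℤ, f (m + 1) - f (m - 1) = ⁅G₁ k, f m⁆) : f = A k := by
  have step : ∀ m : ℤ, A k (m + 1) - A k (m - 1) = ⁅G₁ k, A k m⁆ := A_succ_sub_pred k
  have key : ∀ m : ℤ, f m = A k m ∧ f (m + 1) = A k (m + 1) := by
    intro m
    induction m using Int.induction_on with
    | zero => exact ⟨h0, by rw [zero_add, h1, A_one]⟩
    | succ n ih =>
      refine ⟨ih.2, ?_⟩
      have e1 := h (n + 1)
      have e2 := step (n + 1)
      rw [add_sub_cancel_right] at e1 e2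
      rw [sub_eq_iff_eq_add] at e1 e2
      rw [e1, e2, ih.1, ih.2]
    | pred n ih =>
      have e1 := h (-n)
      have e2 := step (-n)
      rw [sub_add_cancel]
      refine ⟨?_, ih.1⟩
      rw [ih.1, ih.2] at e1
      exact sub_right_injective (e1.trans e2.symm)
  exact funext fun m => (key m).1

end DolanGrady

end

namespace DolanGrady

section Pair

variable {k L : Type*} [Field k] [LieRing L] [LieAlgebra k L]

/-! The recursion makes `A_{m+1}` the reflection of `A_{m-1}` in `A_m`. Reflection preserves
Dolan-Grady pairs, so every consecutive bracket `[A_{m+1}, A_m]` is `2 G_1` (`isPair_A_and_lie`).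
Larger gaps follow by two-step induction (`lie_add_nat_and_lie_G_nat`). Applying `ad G_1` to the
relation for gap `n+1` shows that `[A_{i+n+2}, A_i]` is affine in `i`, with slope `2 [G_1,
G_{n+1}]`. Computing this commutator a second way forces it to vanish in characteristic zero. -/

/-- If eigenvectors for the eigenvalues `4, 2, 0, -2, -4` sum to zero, then so does their
alternating sum. -/
theorem alternating_sum_eq_zero [CharZero k] {M : Type*} [AddCommGroup M] [Module k M] (f : M →ₗ[k] M)
    {p q r s t : M} (hp : f p = (4 : k) • p) (hq : f q = (2 : k) • q) (hr : f r = 0)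
    (hs : f s = (-2 : k) • s) (ht : f t = (-4 : k) • t) (h : p + q + r + s + t = 0) :
    p - q + r - s + t = 0 := by
  have e1 : (4 : k) • p + (2 : k) • q + (-2 : k) • s + (-4 : k) • t = 0 := by
    simpa [hp, hq, hr, hs, ht] using congrArg f h
  have e2 : (16 : k) • p + (4 : k) • q + (4 : k) • s + (16 : k) • t = 0 := by
    have := congrArg f e1
    simp only [map_add, map_smul, hp, hq, hs, ht, map_zero] at this
    linear_combination (norm := module) this
  have e3 : (64 : k) • p + (8 : k) • q + (-8 : k) • s + (-64 : k) • t = 0 := by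
    have := congrArg f e2
    simp only [map_add, map_smul, hp, hq, hs, ht, map_zero] at this
    linear_combination (norm := module) this
  have e4 : (256 : k) • p + (16 : k) • q + (16 : k) • s + (256 : k) • t = 0 := by
    have := congrArg f e3
    simp only [map_add, map_smul, hp, hq, hs, ht, map_zero] at this
    linear_combination (norm := module) this
  -- The polynomial `1 + (x^4 - 16 x^2) / 24` is `1` at `0, ±4` and `-1` at `±2`.
  linear_combination (norm := module) h + (1 / 24 : k) • e4 - (16 / 24 : k) • e2

/-- The Dolan-Grady relations are preserved by the reflection `c + v + w ↦ c - v - w` of the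
second element, where `c`, `v`, `w` are its components of `ad a`-eigenvalues `0`, `2`, `-2`. -/
theorem reflect_of_eigenvectors [CharZero k] {a c v w : L} (hc : ⁅a, c⁆ = 0) (hv : ⁅a, v⁆ = (2 : k) • v)
    (hw : ⁅a, w⁆ = (-2 : k) • w)
    (h : ⁅c + v + w, ⁅c + v + w, v - w⁆⁆ = (4 : k) • (v - w)) :
    ⁅c - v - w, ⁅c - v - w, v - w⁆⁆ = (4 : k) • (v - w) := by
  simp only [lie_add, add_lie, lie_sub, lie_self, lie_zero] at h
  -- Terms are grouped by `ad a`-weight. Negating `v` and `w` in the outer factors flips exactly the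
  -- weights `0, ±4`, giving minus the alternating sum.
  have key := alternating_sum_eq_zero (k := k) (LieAlgebra.ad k L a : L →ₗ[k] L)
    (p := ⁅v, ⁅c, v⁆⁆) (q := ⁅c, ⁅c, v⁆⁆ - ⁅v, ⁅v, w⁆⁆ + ⁅v, ⁅w, v⁆⁆ - (4 : k) • v)
    (r := ⁅c, ⁅w, v⁆⁆ - ⁅c, ⁅v, w⁆⁆ - ⁅v, ⁅c, w⁆⁆ + ⁅w, ⁅c, v⁆⁆)
    (s := ⁅w, ⁅w, v⁆⁆ - ⁅c, ⁅c, w⁆⁆ - ⁅w, ⁅v, w⁆⁆ + (4 : k) • w)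
    (t := -⁅w, ⁅c, w⁆⁆) ?_ ?_ ?_ ?_ ?_ (by linear_combination (norm := module) h)
  · simp only [lie_sub, sub_lie, lie_self, lie_zero]
    linear_combination (norm := module) -key
  all_goals
    simp only [LieAlgebra.ad_apply, lie_add, lie_sub, lie_neg, lie_smul, leibniz_lie a, hc, hv, hw,
      smul_lie, zero_lie, lie_zero]
    module

variable (k) in
/-- A pair of elements satisfying the Dolan-Grady relations. -/
def IsPair (a b : L) : Prop :=
  ⁅a, ⁅a, ⁅a, b⁆⁆⁆ = (4 : k) • ⁅a, b⁆ ∧ ⁅b, ⁅b, ⁅b, a⁆⁆⁆ = (4 : k) • ⁅b, a⁆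

theorem IsPair.symm {a b : L} (h : IsPair k a b) : IsPair k b a := ⟨h.2, h.1⟩

/-- The first element of the pair brackets oppositely with `b` and with the reflection of `b`. -/
theorem IsPair.lie_reflect [CharZero k] {a b : L} (h : IsPair k a b) :
    ⁅a, b - (1 / 2 : k) • ⁅a, ⁅a, b⁆⁆⁆ = -⁅a, b⁆ := by
  rw [lie_sub, lie_smul, h.1]
  module

theorem IsPair.reflect [CharZero k] {a b : L} (h : IsPair k a b) :
    IsPair k a (b - (1 / 2 : k) • ⁅a, ⁅a, b⁆⁆) := by
  have hl := h.lie_reflect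
  refine ⟨by rw [hl, lie_neg, lie_neg, h.1, smul_neg], ?_⟩
  obtain ⟨h1, h2⟩ := h
  -- By the first relation `ad a` is killed by `x(x-2)(x+2)` on `b`; these are the eigencomponents
  -- of `b`, and `v - w` is `½ [a, b]`.
  have hr := reflect_of_eigenvectors (k := k) (a := a) (c := b - (1 / 4 : k) • ⁅a, ⁅a, b⁆⁆)
    (v := (1 / 8 : k) • ⁅a, ⁅a, b⁆⁆ + (1 / 4 : k) • ⁅a, b⁆)
    (w := (1 / 8 : k) • ⁅a, ⁅a, b⁆⁆ - (1 / 4 : k) • ⁅a, b⁆)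
    (by rw [lie_sub, lie_smul, h1]; module)
    (by rw [lie_add, lie_smul, lie_smul, h1]; module)
    (by rw [lie_sub, lie_smul, lie_smul, h1]; module)
  have e1 : b - (1 / 4 : k) • ⁅a, ⁅a, b⁆⁆ + ((1 / 8 : k) • ⁅a, ⁅a, b⁆⁆ + (1 / 4 : k) • ⁅a, b⁆) +
      ((1 / 8 : k) • ⁅a, ⁅a, b⁆⁆ - (1 / 4 : k) • ⁅a, b⁆) = b := by module
  have e2 : b - (1 / 4 : k) • ⁅a, ⁅a, b⁆⁆ - ((1 / 8 : k) • ⁅a, ⁅a, b⁆⁆ + (1 / 4 : k) • ⁅a, b⁆) -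
      ((1 / 8 : k) • ⁅a, ⁅a, b⁆⁆ - (1 / 4 : k) • ⁅a, b⁆) = b - (1 / 2 : k) • ⁅a, ⁅a, b⁆⁆ := by
    module
  have e3 : (1 / 8 : k) • ⁅a, ⁅a, b⁆⁆ + (1 / 4 : k) • ⁅a, b⁆ -
      ((1 / 8 : k) • ⁅a, ⁅a, b⁆⁆ - (1 / 4 : k) • ⁅a, b⁆) = (-1 / 2 : k) • ⁅b, a⁆ := by
    rw [← lie_skew b a]; module
  rw [e1, e2, e3] at hr
  have e4 : ⁅b - (1 / 2 : k) • ⁅a, ⁅a, b⁆⁆, a⁆ = -⁅b, a⁆ := by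
    rw [← lie_skew, hl, lie_skew]
  rw [e4]
  have hr' := hr (by rw [lie_smul, lie_smul, h2]; module)
  rw [lie_smul, lie_smul] at hr'
  rw [lie_neg, lie_neg]
  linear_combination (norm := module) (2 : k) • hr'

end Pair

section Onsager

variable {k : Type*} [Field k]

/-- Consecutive `A_m` satisfy the Dolan-Grady relations and have bracket `2 G_1`. -/
theorem isPair_A_and_lie [CharZero k] (m : ℤ) : IsPair k (A k m) (A k (m + 1)) ∧
    ⁅A k (m + 1), A k m⁆ = (2 : k) • G k 1 := by
  induction m using Int.induction_on with
  | zero =>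
    refine ⟨⟨dolanGrady_one k, dolanGrady_two k⟩, ?_⟩
    rw [G, zero_add]
    module
  | succ n ih =>
    obtain ⟨hp, hl⟩ := ih
    have hA : A k (n + 1 + 1 : ℤ) =
        A k n - (1 / 2 : k) • ⁅A k (n + 1 : ℤ), ⁅A k (n + 1 : ℤ), A k n⁆⁆ := by
      have := A_succ_sub_pred k (n + 1)
      rw [add_sub_cancel_right, ← lie_skew] at this
      rw [hl, lie_smul]
      linear_combination (norm := module) this
    rw [hA]
    refine ⟨hp.symm.reflect, ?_⟩
    rw [← lie_skew, hp.symm.lie_reflect, neg_neg, hl]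
  | pred n ih =>
    obtain ⟨hp, hl⟩ := ih
    have hA : A k (-n - 1 : ℤ) =
        A k (-n + 1 : ℤ) - (1 / 2 : k) • ⁅A k (-n : ℤ), ⁅A k (-n : ℤ), A k (-n + 1 : ℤ)⁆⁆ := by
      have := A_succ_sub_pred k (-n)
      rw [← lie_skew] at this
      rw [← lie_skew (A k (-n : ℤ)) (A k (-n + 1 : ℤ)), hl, lie_neg, lie_smul]
      linear_combination (norm := module) -this
    rw [sub_add_cancel, hA]
    refine ⟨hp.reflect.symm, ?_⟩
    rw [hp.lie_reflect, lie_skew, hl]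

theorem G_zero : G k 0 = 0 := by simp [G]

theorem lie_G_one_A (m : ℤ) : ⁅G k 1, A k m⁆ = A k (m + 1) - A k (m - 1) :=
  (A_succ_sub_pred k m).symm

/-- The Jacobi identity for `A_x, A_y, A_z`, used to get the action of a new `G` from those of known
ones. -/
theorem cyclic_lie [CharZero k] {x y z : ℤ} {u v w : OA k} (hu : ⁅A k x, A k y⁆ = (2 : k) • u)
    (hv : ⁅A k y, A k z⁆ = (2 : k) • v) (hw : ⁅A k x, A k z⁆ = (2 : k) • w) :
    ⁅w, A k y⁆ = ⁅u, A k z⁆ + ⁅v, A k x⁆ := by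
  have h := lie_jacobi (A k x) (A k y) (A k z)
  rw [hv, ← lie_skew (A k z) (A k x), hw, hu, lie_neg, lie_smul, lie_smul, lie_smul,
    ← lie_skew _ v, ← lie_skew _ w, ← lie_skew _ u] at h
  linear_combination (norm := module) (1 / 2 : k) • h

/-- Onsager's first two relations for nonnegative differences. -/
theorem lie_add_nat_and_lie_G_nat [CharZero k] (n : ℕ) :
    (∀ i : ℤ, ⁅A k (i + n), A k i⁆ = (2 : k) • G k n) ∧
    (∀ i : ℤ, ⁅G k n, A k i⁆ = A k (i + n) - A k (i - n)) := by
  induction n using Nat.twoStepInduction with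
  | zero => simp [G_zero]
  | one => exact ⟨fun i => by simpa using (isPair_A_and_lie i).2, fun i => by
      simpa using lie_G_one_A i⟩
  | more n ih0 ih1 =>
    obtain ⟨p0, -⟩ := ih0
    obtain ⟨p1, q1⟩ := ih1
    set D := ⁅G k 1, G k (n + 1 : ℕ)⁆ with hD
    set X : ℤ → OA k := fun i => ⁅A k (i + (n + 2 : ℕ)), A k i⁆ with hX
    -- Under `ad G_1`, `[A_{i+n+2}, A_{i+1}]` yields `X (i+1) - X i`: the two gap-`n` brackets
    -- cancel.
    have step (i : ℤ) : X (i + 1) = X i + (2 : k) • D := by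
      have h := congrArg (fun z => ⁅G k 1, z⁆) (p1 (i + 1))
      simp only [leibniz_lie, lie_G_one_A, lie_smul, sub_lie, lie_sub] at h
      have e1 := p0 (i + 1)
      have e2 := p0 (i + 1 + 1)
      rw [show i + 1 + ((n + 1 : ℕ) : ℤ) + 1 = i + 1 + (n + 2 : ℕ) by push_cast; ring,
        show i + 1 + ((n + 1 : ℕ) : ℤ) - 1 = i + 1 + n by push_cast; ring,
        show i + 1 + ((n + 1 : ℕ) : ℤ) = i + 1 + 1 + n by push_cast; ring, e1, e2,
        show i + 1 + 1 + (n : ℤ) = i + (n + 2 : ℕ) by push_cast; ring, add_sub_cancel_right] at h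
      linear_combination (norm := module) h
    have steps (j : ℕ) : X j = X 0 + (2 * j : k) • D := by
      induction j with
      | zero => simp
      | succ j ih =>
        push_cast
        rw [step, ih]
        module
    have hD0 : D = 0 := by
      -- Applying `ad G_{n+1}` to `[A_{n+2}, A_{n+1}] = 2 G_1` gives `X (n+1) - X 0 = -2 D`, whereas
      -- `steps` gives `2 (n+1) D`.
      have h := congrArg (fun z => ⁅G k (n + 1 : ℕ), z⁆) (isPair_A_and_lie (k := k) (n + 1 : ℕ)).2
      simp only [leibniz_lie _ (A k _), q1, lie_smul, sub_lie, lie_sub] at h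
      have e1 := p0 1
      have e2 := p0 ((n + 1 : ℕ) + 1)
      have e3 : ⁅A k ((n + 1 : ℕ) + 1), A k 0⁆ = X 0 := by
        simp only [hX]; congr 2; push_cast; ring
      rw [show ((n + 1 : ℕ) : ℤ) + 1 + (n + 1 : ℕ) = (n + 1 : ℕ) + (n + 2 : ℕ) by push_cast; ring,
        show ((n + 1 : ℕ) : ℤ) + 1 - (n + 1 : ℕ) = 1 by ring, sub_self, e3, ← lie_skew (A k 1),
        show ((n + 1 : ℕ) : ℤ) = 1 + n by push_cast; ring, e1,
        show (1 + n + (1 + n) : ℤ) = (n + 1 : ℕ) + 1 + n by push_cast; ring,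
        ← lie_skew (A k (1 + (n : ℤ) + 1)),
        show (1 + n + 1 : ℤ) = (n + 1 : ℕ) + 1 by push_cast; ring, e2,
        show (1 + n : ℤ) = (n + 1 : ℕ) by push_cast; ring, ← lie_skew (G k (n + 1 : ℕ))] at h
      have hs : ⁅A k ((n + 1 : ℕ) + (n + 2 : ℕ)), A k (n + 1 : ℕ)⁆ = _ := steps (n + 1)
      rw [hs, ← hD] at h
      have h2 : (2 * (n + 2 : k)) • D = 0 := by
        push_cast at h
        linear_combination (norm := module) h
      refine (smul_eq_zero.mp h2).resolve_left ?_
      exact_mod_cast (by omega : 2 * (n + 2) ≠ 0)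
    have hconst (i : ℤ) : X i = X 0 := by
      induction i using Int.induction_on with
      | zero => rfl
      | succ i ih => rw [step, hD0, smul_zero, add_zero, ih]
      | pred i ih =>
        have := step (-i - 1)
        rw [sub_add_cancel, hD0, smul_zero, add_zero] at this
        rw [← this, ih]
    have p2 (i : ℤ) : ⁅A k (i + (n + 2 : ℕ)), A k i⁆ = (2 : k) • G k (n + 2 : ℕ) := by
      refine (hconst i).trans ?_
      simp only [hX, G, zero_add]
      module
    refine ⟨p2, fun i => ?_⟩
    -- Jacobi for the indices `i+n+1, i, i-1`, whose gaps are `n+1`, `1` and `n+2`.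
    have h1 := (isPair_A_and_lie (k := k) (i - 1)).2
    have h2 := p1 i
    have h3 := p2 (i - 1)
    rw [sub_add_cancel] at h1
    rw [show i - 1 + ((n + 2 : ℕ) : ℤ) = i + (n + 1 : ℕ) by push_cast; ring] at h3
    rw [cyclic_lie h2 h1 h3, q1, lie_G_one_A]
    rw [show i - 1 + ((n + 1 : ℕ) : ℤ) = i + (n + 1 : ℕ) - 1 by ring,
      show i - 1 - ((n + 1 : ℕ) : ℤ) = i - (n + 2 : ℕ) by push_cast; ring,
      show i + ((n + 1 : ℕ) : ℤ) + 1 = i + (n + 2 : ℕ) by push_cast; ring]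
    abel

theorem lie_A_A [CharZero k] (l m : ℤ) : ⁅A k l, A k m⁆ = (2 : k) • G k (l - m) := by
  have hneg (n : ℕ) : G k (-n) = -G k n := by
    have h := (lie_add_nat_and_lie_G_nat (k := k) n).1 (-n)
    rw [neg_add_cancel, ← lie_skew] at h
    rw [G]
    linear_combination (norm := module) (-1 / 2 : k) • h
  obtain ⟨n, hn | hn⟩ := (l - m).eq_nat_or_neg
  · rw [hn, ← (lie_add_nat_and_lie_G_nat n).1 m, ← hn, add_sub_cancel]
  · rw [hn, hneg, smul_neg, ← (lie_add_nat_and_lie_G_nat n).1 l, ← lie_skew,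
      show l + n = m by linarith]

theorem G_neg [CharZero k] (l : ℤ) : G k (-l) = -G k l := by
  have h := lie_A_A (k := k) 0 l
  rw [zero_sub, ← lie_skew] at h
  rw [G, G] at *
  linear_combination (norm := module) (-1 / 2 : k) • h

theorem lie_G_A [CharZero k] (l m : ℤ) : ⁅G k l, A k m⁆ = A k (m + l) - A k (m - l) := by
  obtain ⟨n, rfl | rfl⟩ := l.eq_nat_or_neg
  · exact (lie_add_nat_and_lie_G_nat n).2 m
  · rw [G_neg, neg_lie, (lie_add_nat_and_lie_G_nat n).2 m, sub_neg_eq_add, ← sub_eq_add_neg,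
      neg_sub]

theorem lie_G_G [CharZero k] (l m : ℤ) : ⁅G k l, G k m⁆ = 0 := by
  -- Expanding `G_m` as a bracket leaves `±G_{m+l}` and `±G_{m-l}`, which cancel.
  rw [G.eq_1 k m, lie_smul, leibniz_lie, lie_G_A, lie_G_A, sub_lie, lie_sub, lie_A_A, lie_A_A,
    lie_A_A, lie_A_A, zero_add, zero_sub, sub_zero, sub_zero, sub_neg_eq_add]
  module

end Onsager

end DolanGrady

/-- Onsager's relations in the Dolan-Grady algebra over a field of characteristic zero. -/
theorem mainTheorem2 (k : Type*) [Field k] [CharZero k] :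
    (∀ l m : ℤ, ⁅DolanGrady.A k l, DolanGrady.A k m⁆ = (2 : k) • DolanGrady.G k (l - m)) ∧
    (∀ l m : ℤ, ⁅DolanGrady.G k l, DolanGrady.A k m⁆ =
      DolanGrady.A k (m + l) - DolanGrady.A k (m - l)) ∧
    (∀ l m : ℤ, ⁅DolanGrady.G k l, DolanGrady.G k m⁆ = 0) ∧
    (∀ l m l' m' : ℤ, l - m = l' - m' →
      ⁅DolanGrady.A k l, DolanGrady.A k m⁆ = ⁅DolanGrady.A k l', DolanGrady.A k m'⁆) :=
  ⟨DolanGrady.lie_A_A, DolanGrady.lie_G_A, DolanGrady.lie_G_G, fun l m l' m' h => by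
    rw [DolanGrady.lie_A_A, DolanGrady.lie_A_A, h]⟩
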